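/- Let $T$ be a complete NIP theory in a first-order language $\mathcal L$, let $M\models T$, and let $M\prec N$ be an $|M|^+$-saturated elementary extension. Let $M^{sh}$ be the Shelah expansion of $M$: the structure with universe $M$ in the language $\mathcal L^{sh}=\mathcal L\cup\{R_{\varphi(x,c)}:\varphi(x,y)\in\mathcal L,\ c\in N\}$, where the symbols of $\mathcal L$ are interpreted as in $M$ and $M^{sh}\models R_{\varphi(x,c)}(a)$ if and only if $N\models\varphi(a,c)$. Let $\mathbb U^*\succ M^{sh}$ be a large saturated model of $\mathrm{Th}(M^{sh})$ (it is enough that $\mathbb U^*$ is $\kappa$-saturated for some $\kappa>|M|$), and let $\mathbb U=\mathbb U^*\restriction\mathcal L$. Let $p$ be a global type, i.e. a complete $\mathcal L$-type over $\mathbb U$ in finitely many variables. A global type $p$ is *definable over* a set $A$ if for every formula $\varphi(x,y)$ the set of tuples $b$ with $\varphi(x,b)\in p$ is definable by a formula with parameters in $A$; it is *finitely satisfiable in* $A$ if every formula in $p$ is satisfied by a tuple from $A$; it is *generically stable over* a small elementary submodel if it is definable over and finitely satisfiable in that submodel. The same terms are used for complete $\mathcal L^{sh}$-types over $\mathbb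 U^*$, with respect to $\mathcal L^{sh}$. 1. If $A\subseteq M$ and $p$ is definable over $A$ and finitely satisfiable in $A$, then there is a unique complete type $q\in S^{\mathcal L^{sh}}(\mathbb U^*)$ extending $p$ which is definable over $A$ and finitely satisfiable in $A$. Moreover, this $q$ is generically stable over $M$. 2. If $p$ is generically stable over $M$, then there is a unique $q\in S^{\mathcal L^{sh}}(\mathbb U^*)$ extending $p$ which is generically stable over $M$. -/

import Mathlib

open FirstOrder FirstOrder.Language Cardinal

universe u v w x y

namespace FirstOrder.Language

section NIP

variable {L : FirstOrder.Language.{u, v}}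

/-- `φ(x; y)` shatters the `k` tuples `a 0, …, a (k-1)` in `M`: every subset of them is cut out
by an instance of `φ`. -/
def Formula.Shatters {α β : Type*} (φ : L.Formula (α ⊕ β)) {M : Type*} [L.Structure M] {k : ℕ}
    (a : Fin k → α → M) : Prop :=
  ∀ I : Set (Fin k), ∃ b : β → M, ∀ i, φ.Realize (Sum.elim (a i) b) ↔ i ∈ I

/-- `T` is NIP (has no formula with the independence property): for every formula `φ(x; y)` there
is a `k` such that in no model of `T` are `k` tuples shattered by `φ`. -/
def Theory.IsNIP (T : L.Theory) : Prop :=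
  ∀ (m l : ℕ) (φ : L.Formula (Fin m ⊕ Fin l)), ∃ k : ℕ,
    ∀ (M : Theory.ModelType.{u, v, max u v} T) (a : Fin k → Fin m → M), ¬ φ.Shatters a

end NIP

section Saturation

/-- `U` is `κ`-saturated: for every set `A ⊆ U` of fewer than `κ` parameters, every set of formulas
over `A` in finitely many variables which is finitely satisfiable in `U` is realized in `U`. -/
def IsSaturatedIn (L : FirstOrder.Language.{u, v}) (U : Type w) [L.Structure U] (κ : Cardinal.{x}) : Prop :=
  ∀ A : Set U, Cardinal.lift.{x} #A < Cardinal.lift.{w} κ →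
    ∀ (n : ℕ) (S : Set (L[[A]].Formula (Fin n))),
      (∀ F : Finset (L[[A]].Formula (Fin n)), (F : Set (L[[A]].Formula (Fin n))) ⊆ S →
        ∃ c : Fin n → U, ∀ φ ∈ F, φ.Realize c) →
      ∃ c : Fin n → U, ∀ φ ∈ S, φ.Realize c

end Saturation

section Shelah

variable (L : FirstOrder.Language.{u, v})

/-- The new symbols of the Shelah expansion: an `n`-ary relation symbol `R_{φ(x, c)}` for each
`L`-formula `φ(x, c)` in `n` variables with parameters `c` from `N`. -/
def externalLanguage (N : Type w) : FirstOrder.Language.{u, max u v w} where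
  Functions _ := PEmpty
  Relations n := L[[N]].Formula (Fin n)

/-- The language `L^sh = L ∪ {R_{φ(x, c)}}`. -/
abbrev shelahLanguage (N : Type w) : FirstOrder.Language.{u, max u v w} :=
  L.sum (externalLanguage L N)

/-- The inclusion of `L` in `L^sh`. -/
abbrev toShelah (N : Type w) : L →ᴸ shelahLanguage L N :=
  LHom.sumInl

variable {L}

/-- The universe of `M^sh`, for `j : M ≺ N`. -/
def ShelahExpansion {M : Type x} {N : Type w} [L.Structure M] [L.Structure N]
    (_j : M ↪ₑ[L] N) : Type x :=
  M

variable {M : Type x} {N : Type w} [L.Structure M] [L.Structure N] (j : M ↪ₑ[L] N)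

instance : L.Structure (ShelahExpansion j) :=
  inferInstanceAs (L.Structure M)

/-- `R_{φ(x, c)}` holds of `a` in `M^sh` iff `φ(a, c)` holds in `N`. -/
instance : (externalLanguage L N).Structure (ShelahExpansion j) where
  funMap f := PEmpty.elim f
  RelMap {n} (φ : L[[N]].Formula (Fin n)) (a : Fin n → M) := φ.Realize (fun k => j (a k))

end Shelah

section GlobalTypes

/-- Complete types in `n` variables over the structure `U` (global types, when `U` is a monster
model). -/
abbrev GlobalType (L : FirstOrder.Language.{u, v}) (U : Type w) [L.Structure U] (n : ℕ) :=
  (L.elementaryDiagram U).CompleteType (Fin n)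

namespace GlobalType

variable {L : FirstOrder.Language.{u, v}} {U : Type w} [L.Structure U] {n : ℕ}

/-- The formula `φ(x)`, with parameters in `U`, belongs to `p(x)`. -/
def Has (p : GlobalType L U n) (φ : L[[U]].Formula (Fin n)) : Prop :=
  Formula.equivSentence φ ∈ p

/-- The formula `φ(b, x)` over `U` obtained from `φ(y, x)` by substituting `b` for `y`. -/
def inst {m : ℕ} (φ : L.Formula (Fin m ⊕ Fin n)) (b : Fin m → U) : L[[U]].Formula (Fin n) :=
  BoundedFormula.constantsVarsEquiv.symm (Formula.relabel (Sum.map b id) φ)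

/-- `p` is definable over `A`: for each `φ(y, x)` the set of `b` with `φ(b, x) ∈ p` is
`A`-definable. -/
def IsDefinableOver (p : GlobalType L U n) (A : Set U) : Prop :=
  ∀ (m : ℕ) (φ : L.Formula (Fin m ⊕ Fin n)), A.Definable L {b : Fin m → U | p.Has (inst φ b)}

/-- `p` is finitely satisfiable in `A`: each formula in `p` is satisfied by a tuple from `A`. -/
def IsFinitelySatisfiableIn (p : GlobalType L U n) (A : Set U) : Prop :=
  ∀ φ : L[[U]].Formula (Fin n), p.Has φ → ∃ a : Fin n → U, (∀ k, a k ∈ A) ∧ φ.Realize a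

/-- `p` is generically stable over `S`: `S` is (the universe of) an elementary submodel of `U`, and
`p` is definable over `S` and finitely satisfiable in `S`. -/
def IsGenericallyStableOver (p : GlobalType L U n) (S : Set U) : Prop :=
  (∃ S' : L.ElementarySubstructure U, (S' : Set U) = S) ∧
    p.IsDefinableOver S ∧ p.IsFinitelySatisfiableIn S

/-- `q`, a type in an expansion of `U` along `f : L → L'`, extends the type `p`. -/
def IsExtendedBy {L' : FirstOrder.Language} [L'.Structure U] (f : L →ᴸ L') (p : GlobalType L U n)
    (q : GlobalType L' U n) : Prop :=
  ∀ φ : L[[U]].Formula (Fin n), p.Has φ → q.Has ((f.addConstants U).onFormula φ)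

end GlobalType

end GlobalTypes

end FirstOrder.Language

/-!
The proof works throughout with ultrafilters on the set `Mⁿ` of `n`-tuples of the small model.

*From types to ultrafilters.* A type over `U` is finitely satisfiable in `A ⊆ M` iff it is the limit
of an ultrafilter `P` on `Mⁿ` that contains `Aⁿ`
(`GlobalType.IsFinitelySatisfiableIn.exists_ultrafilter`). If moreover the limit is definable over
`M`, then `P` is definable over `M`, and by saturation of `U` a definable family of sets comes with
finitely many tuples of `M` that meet every `P`-large member of the family. These two properties,
which mention only the structure `M`, make up `IsDefinableAndCovered`.

*The engine.* Suppose that `X = φ(M, c)` is externally definable (`c` from an elementary extension)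
and that for an ultrafilter `P` all patterns of membership in `X` and its complement occur inside
every definable set in a power of `P`. Then `φ` has the independence property
(`exists_shatters_of_ultrafilter`). It is used twice.

* If `P` is definable and covered, the definition of `P` over `M` remains correct for parameters
  from any elementary extension (`IsDefinableAndCovered.realize_iff_eventually`). Consequently two
  such ultrafilters that agree on definable sets agree on externally definable sets
  (`IsDefinableAndCovered.eventually_congr`).
* Every externally definable set `X` has an honest definition: there is a definable family such that
  each finite subset of `X` lies in a member contained in `X` (`IsExternal.isHonest`). By saturation
  of `N` the projection of an externally definable set is then externally definable, which is
  Shelah's theorem (`IsExternal.exists_of_finite`): the sets definable in `Mˢʰ` are exactly the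
  externally definable ones.

*Conclusion.* Let `P` be an ultrafilter with limit `p`. It is definable and covered for `L`, and the
first use of the engine, for `M ≺ N`, shows with Shelah's theorem that it is definable and covered
for `Lˢʰ`. The structure `Mˢʰ` has NIP because `N` has, so the engine applies once more, to
`Mˢʰ ≺ U`: the limit `q` of `P` in the language `Lˢʰ` is a definable type, with definitions that are
single relation symbols and thus need no parameters. It extends `p` and is finitely satisfiable in
`A` because `P` contains `Aⁿ`. Uniqueness holds already among the extensions finitely satisfiable in
`M`: two of them are limits of ultrafilters with the same limit in `L`, and these agree first on the
externally definable sets, then on the traces of the sets definable in `U`.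
-/

section

universe z

open Filter Set

/-! ### Powers of ultrafilters, definable sets and shattering -/

/-- The `k`-th power of an ultrafilter: the quantifier `∀ᶠ a in P.pow k` is
`∀ᶠ a₀ in P, …, ∀ᶠ aₖ₋₁ in P`, the outermost variable coming first. -/
def Ultrafilter.pow {α : Type*} (P : Ultrafilter α) : ∀ k : ℕ, Ultrafilter (Fin k → α)
  | 0 => pure Fin.elim0
  | k + 1 => P.bind fun a => (P.pow k).map (fun v => (Fin.cons a v : Fin (k + 1) → α))

theorem Ultrafilter.eventually_pow_zero {α : Type*} (P : Ultrafilter α)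
    {p : (Fin 0 → α) → Prop} : (∀ᶠ v in P.pow 0, p v) ↔ p Fin.elim0 :=
  Iff.rfl

theorem Ultrafilter.eventually_pow_succ {α : Type*} (P : Ultrafilter α) {k : ℕ}
    {p : (Fin (k + 1) → α) → Prop} :
    (∀ᶠ v in P.pow (k + 1), p v) ↔ ∀ᶠ a in P, ∀ᶠ v in P.pow k, p (Fin.cons a v) :=
  Iff.rfl

namespace FirstOrder.Language

section Definability

variable {L : FirstOrder.Language.{u, v}} {M : Type w} [L.Structure M] {γ δ : Type*}

theorem definable_univ_iff_exists_formula {S : Set (γ → M)} :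
    univ.Definable L S ↔
      ∃ φ : L.Formula (M ⊕ γ), ∀ v, v ∈ S ↔ φ.Realize (Sum.elim id v) := by
  rw [definable_iff_exists_formula_sum]
  constructor
  · rintro ⟨φ, rfl⟩
    refine ⟨φ.relabel (Sum.map (↑) id), fun v => ?_⟩
    rw [Formula.realize_relabel, Sum.elim_comp_map]
    rfl
  · rintro ⟨φ, h⟩
    refine ⟨φ.relabel (Sum.map (fun m => ⟨m, mem_univ m⟩) id), ?_⟩
    ext v
    rw [h, mem_ofPred_eq, Formula.realize_relabel, Sum.elim_comp_map]
    rfl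

theorem definable_univ_of_formula (φ : L.Formula (M ⊕ γ)) :
    univ.Definable L {v : γ → M | φ.Realize (Sum.elim id v)} :=
  definable_univ_iff_exists_formula.2 ⟨φ, fun _ => Iff.rfl⟩

/-- Only finitely many of the variables in `δ` occur in a formula. The structure is quantified
inside, so that one choice of variables serves a structure and its extensions. -/
theorem Formula.exists_finite_variables (φ : L.Formula (δ ⊕ γ)) :
    ∃ (l : ℕ) (f : Fin l → δ) (ψ : L.Formula (γ ⊕ Fin l)), ∀ (K : Type x) [L.Structure K]
      (c : δ → K) (v : γ → K), φ.Realize (Sum.elim c v) ↔ ψ.Realize (Sum.elim v (c ∘ f)) := by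
  classical
  let s : Finset δ := φ.freeVarFinset.toLeft
  let e := s.equivFin
  let g : φ.freeVarFinset → γ ⊕ Fin s.card := fun z =>
    match z with
    | ⟨Sum.inl d, h⟩ => Sum.inr (e ⟨d, Finset.mem_toLeft.2 h⟩)
    | ⟨Sum.inr c, _⟩ => Sum.inl c
  refine ⟨s.card, fun t => (e.symm t : δ), BoundedFormula.restrictFreeVar φ g,
    fun K _ c v => ?_⟩
  refine (BoundedFormula.realize_restrictFreeVar (Sum.elim c v) ?_).symm
  rintro ⟨z | z, h⟩ <;> simp [g]

/-- A definable set is a fibre of a set definable without parameters. -/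
theorem exists_formula_of_definable_univ {S : Set (γ → M)} (hS : univ.Definable L S) :
    ∃ (l : ℕ) (φ : L.Formula (γ ⊕ Fin l)) (c : Fin l → M),
      ∀ v, v ∈ S ↔ φ.Realize (Sum.elim v c) := by
  obtain ⟨φ, h⟩ := definable_univ_iff_exists_formula.1 hS
  obtain ⟨l, f, ψ, hψ⟩ := φ.exists_finite_variables
  exact ⟨l, ψ, f, fun v => (h v).trans (hψ M id v)⟩

theorem definable_fibre {S : Set (γ ⊕ δ → M)} (hS : univ.Definable L S) (a : γ → M) :
    univ.Definable L {v : δ → M | Sum.elim a v ∈ S} := by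
  obtain ⟨φ, h⟩ := definable_univ_iff_exists_formula.1 hS
  refine definable_univ_iff_exists_formula.2
    ⟨φ.relabel (Sum.elim Sum.inl (Sum.elim (Sum.inl ∘ a) Sum.inr)), fun v => ?_⟩
  rw [mem_ofPred_eq, h, Formula.realize_relabel]
  refine iff_of_eq (congrArg _ ?_)
  ext (_ | _ | _) <;> rfl

theorem definable_preimage_relabel {S : Set (γ → M)} (hS : univ.Definable L S) (f : γ → δ) :
    univ.Definable L {v : δ → M | v ∘ f ∈ S} :=
  hS.preimage_comp f

/-- A formula with parameters from `M` valid in `M` is valid in each elementary extension. -/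
theorem ElementaryEmbedding.realize_of_forall_realize {N : Type y} [L.Structure N]
    (j : M ↪ₑ[L] N) [Finite γ] (χ : L.Formula (M ⊕ γ))
    (h : ∀ v : γ → M, χ.Realize (Sum.elim id v)) (v : γ → N) : χ.Realize (Sum.elim j v) := by
  have h1 : (χ.iAlls γ).Realize (id : M → M) := Formula.realize_iAlls.2 h
  rw [← j.map_formula] at h1
  exact Formula.realize_iAlls.1 h1 v

theorem ElementaryEmbedding.realize_elim {N : Type y} [L.Structure N]
    (j : M ↪ₑ[L] N) (χ : L.Formula (M ⊕ γ)) (v : γ → M) :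
    χ.Realize (Sum.elim j (j ∘ v)) ↔ χ.Realize (Sum.elim id v) := by
  rw [← j.map_formula]
  refine iff_of_eq (congrArg _ ?_)
  ext (_ | _) <;> rfl

end Definability

section Shatter

variable {L : FirstOrder.Language.{u, v}} {α β : Type} [Finite β] {k : ℕ}

open Classical in
/-- The formula in `x 0, …, x (k-1)` saying that some instance of `φ` holds of `x i` exactly for
`i ∈ s`. -/
noncomputable def Formula.pattern (φ : L.Formula (α ⊕ β)) (s : Set (Fin k)) :
    L.Formula (Fin k × α) :=
  Formula.iExs β (Formula.iInf fun i : Fin k =>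
    if i ∈ s then φ.relabel (Sum.map (Prod.mk i) id) else ∼(φ.relabel (Sum.map (Prod.mk i) id)))

theorem Formula.realize_pattern (φ : L.Formula (α ⊕ β)) (s : Set (Fin k)) {M : Type*}
    [L.Structure M] (a : Fin k × α → M) :
    (φ.pattern s).Realize a ↔
      ∃ b : β → M, ∀ i, φ.Realize (Sum.elim (fun t => a (i, t)) b) ↔ i ∈ s := by
  rw [Formula.pattern, Formula.realize_iExs]
  refine exists_congr fun b => ?_
  rw [Formula.realize_iInf]
  refine forall_congr' fun i => ?_
  split_ifs with h
  · rw [Formula.realize_relabel, Sum.elim_comp_map, iff_true_right h]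
    rfl
  · rw [Formula.realize_not, Formula.realize_relabel, Sum.elim_comp_map, iff_false_right h]
    rfl

theorem Formula.shatters_iff (φ : L.Formula (α ⊕ β)) {M : Type*} [L.Structure M]
    (a : Fin k → α → M) :
    φ.Shatters a ↔ ∀ s : Set (Fin k), (φ.pattern s).Realize fun z => a z.1 z.2 :=
  forall_congr' fun s => (φ.realize_pattern s fun z => a z.1 z.2).symm

variable {M : Type w} [L.Structure M] {N : Type y} [L.Structure N]

/-- The common engine of the two uses of NIP. If the powers of an ultrafilter `P` on `M^α` cannot
tell apart the external set `φ(M, c)` and its complement, in the sense that every definable set in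
a power of `P` contains a tuple with any prescribed pattern of memberships, then `φ` has the
independence property: each `φ.pattern s` must lie in the power of `P`, since `c` itself shows that
its complement contains no tuple with pattern `s`. -/
theorem exists_shatters_of_ultrafilter (j : M ↪ₑ[L] N) (φ : L.Formula (α ⊕ β)) (c : β → N)
    (P : Ultrafilter (α → M))
    (H : ∀ (k : ℕ) (Θ : Set (Fin k × α → M)), univ.Definable L Θ →
      (∀ᶠ a : Fin k → α → M in P.pow k, (fun z => a z.1 z.2) ∈ Θ) → ∀ s : Set (Fin k), ∃ a : Fin k → α → M,
        (fun z => a z.1 z.2) ∈ Θ ∧ ∀ i, φ.Realize (Sum.elim (j ∘ a i) c) ↔ i ∈ s) (k : ℕ) :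
    ∃ a : Fin k → α → M, φ.Shatters a := by
  have key : ∀ s : Set (Fin k),
      ∀ᶠ a : Fin k → α → M in P.pow k, (φ.pattern s).Realize fun z => a z.1 z.2 := by
    intro s
    refine ((P.pow k).em _).resolve_right fun hn => ?_
    have hdef : univ.Definable L {v : Fin k × α → M | ¬ (φ.pattern s).Realize v} := by
      refine Definable.compl (definable_univ_iff_exists_formula.2
        ⟨(φ.pattern s).relabel Sum.inr, fun v => ?_⟩)
      rw [Formula.realize_relabel]
      rfl
    obtain ⟨a, ha, hs⟩ := H k _ hdef hn s
    refine ha ?_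
    rw [← j.map_formula, Formula.realize_pattern]
    exact ⟨c, hs⟩
  obtain ⟨a, ha⟩ := (eventually_all.2 key).exists
  exact ⟨a, (φ.shatters_iff a).2 ha⟩

end Shatter

end FirstOrder.Language

/-! ### Definable and covered ultrafilters -/

namespace FirstOrder.Language

section DFS

variable (L : FirstOrder.Language.{u, v}) (M : Type w) [L.Structure M]

/-- No `L`-formula has the independence property in the structure `M`. -/
def HasNIP : Prop :=
  ∀ (m l : ℕ) (φ : L.Formula (Fin m ⊕ Fin l)), ∃ k : ℕ, ∀ a : Fin k → Fin m → M, ¬ φ.Shatters a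

variable {L M}

theorem HasNIP.exists_not_shatters (h : HasNIP L M) {α β : Type} [Finite α] [Finite β]
    (φ : L.Formula (α ⊕ β)) : ∃ k : ℕ, ∀ a : Fin k → α → M, ¬ φ.Shatters a := by
  obtain ⟨m, ⟨e⟩⟩ := Finite.exists_equiv_fin α
  obtain ⟨l, ⟨f⟩⟩ := Finite.exists_equiv_fin β
  obtain ⟨k, hk⟩ := h m l (φ.relabel (Sum.map e f))
  refine ⟨k, fun a ha => hk (fun i => a i ∘ e.symm) fun s => ?_⟩
  obtain ⟨b, hb⟩ := ha s
  refine ⟨b ∘ f.symm, fun i => ?_⟩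
  rw [Formula.realize_relabel, Sum.elim_comp_map]
  simpa [Function.comp_def] using hb i

variable {n : ℕ}

variable (L) in
/-- The type over `M` given by the ultrafilter `P` is definable, and it is finitely satisfiable
with a uniform bound: for each definable family of sets there are finitely many tuples such that
every member of the family that is large for `P` contains one of them. -/
structure IsDefinableAndCovered (P : Ultrafilter (Fin n → M)) : Prop where
  definable : ∀ {γ : Type} [Finite γ] (S : Set (γ ⊕ Fin n → M)), univ.Definable L S →
    univ.Definable L {b : γ → M | ∀ᶠ a in P, Sum.elim b a ∈ S}
  cover : ∀ {γ : Type} [Finite γ] (S : Set (γ ⊕ Fin n → M)), univ.Definable L S →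
    ∃ F : Finset (Fin n → M), ∀ b : γ → M, (∀ᶠ a in P, Sum.elim b a ∈ S) →
      ∃ a ∈ F, Sum.elim b a ∈ S

variable {P : Ultrafilter (Fin n → M)}

theorem IsDefinableAndCovered.definable_pow (hP : IsDefinableAndCovered L P) (k : ℕ) {γ : Type}
    [Finite γ] (S : Set (γ ⊕ (Fin k × Fin n) → M)) (hS : univ.Definable L S) :
    univ.Definable L
      {b : γ → M | ∀ᶠ a : Fin k → Fin n → M in P.pow k, Sum.elim b (fun z => a z.1 z.2) ∈ S} := by
  induction k generalizing γ with
  | zero =>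
    simp only [Ultrafilter.eventually_pow_zero]
    convert definable_preimage_relabel hS (Sum.elim id fun z : Fin 0 × Fin n => z.1.elim0)
      using 4 with b
    ext (_ | ⟨i, _⟩)
    · rfl
    · exact i.elim0
  | succ k ih =>
    simp only [Ultrafilter.eventually_pow_succ]
    let f : γ ⊕ (Fin (k + 1) × Fin n) → (γ ⊕ Fin n) ⊕ (Fin k × Fin n) :=
      Sum.elim (Sum.inl ∘ Sum.inl) fun z =>
        Fin.cases (Sum.inl (Sum.inr z.2)) (fun i => Sum.inr (i, z.2)) z.1
    convert hP.definable _ (ih _ (definable_preimage_relabel hS f)) using 5 with b a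
    refine iff_of_eq (congrArg (Filter.Eventually · _) ?_)
    ext v
    refine iff_of_eq (congrArg (· ∈ S) ?_)
    ext (_ | ⟨i, t⟩)
    · rfl
    · refine Fin.cases ?_ (fun i => ?_) i <;> rfl

/-- The covering property of a definable and covered type persists in elementary extensions. -/
theorem IsDefinableAndCovered.exists_finset_cover (hP : IsDefinableAndCovered L P) {N : Type y}
    [L.Structure N] (j : M ↪ₑ[L] N) {γ : Type} [Finite γ] (φ : L.Formula (M ⊕ (γ ⊕ Fin n)))
    (d : L.Formula (M ⊕ γ)) (hd : ∀ b : γ → M, d.Realize (Sum.elim id b) →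
      ∀ᶠ a in P, φ.Realize (Sum.elim id (Sum.elim b a))) :
    ∃ F : Finset (Fin n → M), ∀ c : γ → N, d.Realize (Sum.elim j c) →
      ∃ a ∈ F, φ.Realize (Sum.elim j (Sum.elim c (j ∘ a))) := by
  obtain ⟨F, hF⟩ := hP.cover _ (definable_univ_of_formula φ)
  refine ⟨F, fun c hc => ?_⟩
  let χ : L.Formula (M ⊕ γ) := d.imp (Formula.iSup fun a : F =>
    φ.relabel (Sum.elim Sum.inl (Sum.elim Sum.inr fun t => Sum.inl (a.1 t))))
  have hχ := j.realize_of_forall_realize χ (fun b => by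
    rw [Formula.realize_imp, Formula.realize_iSup]
    intro hb
    obtain ⟨a, haF, ha⟩ := hF b (hd b hb)
    refine ⟨⟨a, haF⟩, ?_⟩
    rw [mem_ofPred_eq] at ha
    rw [Formula.realize_relabel]
    convert ha using 1
    ext (_ | _ | _) <;> rfl) c
  rw [Formula.realize_imp, Formula.realize_iSup] at hχ
  obtain ⟨⟨a, haF⟩, ha⟩ := hχ hc
  refine ⟨a, haF, ?_⟩
  rw [Formula.realize_relabel] at ha
  convert ha using 1
  ext (_ | _ | _) <;> rfl

/-- Half of the fact that, under NIP, the definition of a definable and covered type over `M` remains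
correct in an elementary extension `N`: for `c` in `N`, if `d(c)` holds then `φ(c, M)` is large for
`P`. If `d(c)` holds but `φ(c, M)` is small, then every definable set in `P` meets both
`φ(c, M)` (by covering) and its complement (which is large). By definability of `P`, tuples with any
prescribed pattern can then be chosen one coordinate at a time. -/
theorem IsDefinableAndCovered.eventually_of_realize (hP : IsDefinableAndCovered L P)
    (hM : HasNIP L M) {N : Type y} [L.Structure N] (j : M ↪ₑ[L] N) {γ : Type} [Finite γ]
    (φ : L.Formula (γ ⊕ Fin n)) (d : L.Formula (M ⊕ γ))
    (hd : ∀ b : γ → M, d.Realize (Sum.elim id b) ↔ ∀ᶠ a in P, φ.Realize (Sum.elim b a))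
    (c : γ → N) (hc : d.Realize (Sum.elim j c)) :
    ∀ᶠ a in P, φ.Realize (Sum.elim c (j ∘ a)) := by
  by_contra hX
  rw [← Ultrafilter.eventually_not] at hX
  have hmeet : ∀ Y : Set (Fin n → M), univ.Definable L Y → (∀ᶠ a in P, a ∈ Y) →
      ∃ a ∈ Y, φ.Realize (Sum.elim c (j ∘ a)) := by
    intro Y hY hYP
    obtain ⟨ψ, hψ⟩ := definable_univ_iff_exists_formula.1 hY
    let θ : L.Formula (M ⊕ (γ ⊕ Fin n)) := φ.relabel Sum.inr ⊓ ψ.relabel (Sum.map id Sum.inr)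
    obtain ⟨F, hF⟩ := hP.exists_finset_cover j θ d fun b hb =>
      (((hd b).1 hb).and hYP).mono fun a ha => by
        rw [Formula.realize_inf, Formula.realize_relabel, Formula.realize_relabel,
          Sum.elim_comp_map]
        exact ⟨ha.1, (hψ a).1 ha.2⟩
    obtain ⟨a, -, ha⟩ := hF c hc
    rw [Formula.realize_inf, Formula.realize_relabel, Formula.realize_relabel,
      Sum.elim_comp_map] at ha
    exact ⟨a, (hψ a).2 ((j.realize_elim ψ a).1 ha.2), ha.1⟩
  obtain ⟨k, hk⟩ := hM.exists_not_shatters (φ.relabel Sum.swap)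
  refine Exists.elim
    (exists_shatters_of_ultrafilter j (φ.relabel Sum.swap) c P (fun k => ?_) k) hk
  have hswap : ∀ a : Fin n → M, (φ.relabel Sum.swap).Realize (Sum.elim (j ∘ a) c) ↔
      φ.Realize (Sum.elim c (j ∘ a)) := by
    intro a
    rw [Formula.realize_relabel]
    refine iff_of_eq (congrArg _ ?_)
    ext (_ | _) <;> rfl
  simp only [hswap]
  induction k with
  | zero =>
    intro Θ _ h s
    exact ⟨Fin.elim0, h, fun i => i.elim0⟩
  | succ k ih =>
    intro Θ hΘ h s
    let f : Fin (k + 1) × Fin n → Fin n ⊕ (Fin k × Fin n) := fun z =>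
        Fin.cases (Sum.inl z.2) (fun i => Sum.inr (i, z.2)) z.1
    have hf : ∀ (a : Fin n → M) (v : Fin k → Fin n → M),
        Sum.elim a (fun z : Fin k × Fin n => v z.1 z.2) ∘ f =
          fun z => (Fin.cons a v : Fin (k + 1) → Fin n → M) z.1 z.2 := by
      intro a v
      ext ⟨i, t⟩
      refine Fin.cases ?_ (fun i => ?_) i <;> rfl
    have hΘ' := definable_preimage_relabel hΘ f
    rw [Ultrafilter.eventually_pow_succ] at h
    simp only [← hf] at h
    have hY := hP.definable_pow k _ hΘ'
    obtain ⟨a, haY, ha⟩ : ∃ a : Fin n → M,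
        (∀ᶠ v : Fin k → Fin n → M in P.pow k, Sum.elim a (fun z : Fin k × Fin n => v z.1 z.2) ∘ f ∈ Θ) ∧
          (φ.Realize (Sum.elim c (j ∘ a)) ↔ 0 ∈ s) := by
      by_cases h0 : (0 : Fin (k + 1)) ∈ s
      · obtain ⟨a, h1, h2⟩ := hmeet _ hY h
        exact ⟨a, h1, iff_of_true h2 h0⟩
      · obtain ⟨a, h1, h2⟩ := (h.and hX).exists
        exact ⟨a, h1, iff_of_false h2 h0⟩
    obtain ⟨v, hv, hvs⟩ := ih _ (definable_fibre hΘ' a) haY {i | i.succ ∈ s}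
    refine ⟨Fin.cons a v, ?_, Fin.cases ha hvs⟩
    rw [← hf]
    exact hv

/-- The other half follows by applying the first one to `¬φ`. -/
theorem IsDefinableAndCovered.realize_iff_eventually (hP : IsDefinableAndCovered L P)
    (hM : HasNIP L M) {N : Type y} [L.Structure N] (j : M ↪ₑ[L] N) {γ : Type} [Finite γ]
    (φ : L.Formula (γ ⊕ Fin n)) (d : L.Formula (M ⊕ γ))
    (hd : ∀ b : γ → M, d.Realize (Sum.elim id b) ↔ ∀ᶠ a in P, φ.Realize (Sum.elim b a))
    (c : γ → N) :
    d.Realize (Sum.elim j c) ↔ ∀ᶠ a in P, φ.Realize (Sum.elim c (j ∘ a)) := by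
  refine ⟨hP.eventually_of_realize hM j φ d hd c, fun h => ?_⟩
  by_contra hc
  have := hP.eventually_of_realize hM j (∼φ) (∼d) (fun b => by
    simp only [Formula.realize_not, Ultrafilter.eventually_not, hd]) c
    (by rwa [Formula.realize_not])
  simp only [Formula.realize_not, Ultrafilter.eventually_not] at this
  exact this h

end DFS

end FirstOrder.Language

/-! ### Honest definitions and Shelah's theorem -/

namespace FirstOrder.Language

section External

variable {L : FirstOrder.Language.{u, v}}

theorem Formula.realize_constantsVarsEquiv_symm {C δ : Type*} {K : Type*} [L.Structure K]
    [L[[C]].Structure K] [(lhomWithConstants L C).IsExpansionOn K] (φ : L.Formula (C ⊕ δ))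
    (v : δ → K) : Formula.Realize (BoundedFormula.constantsVarsEquiv.symm φ : L[[C]].Formula δ) v ↔
      φ.Realize (Sum.elim (fun c => (L.con c : K)) v) := by
  have h := BoundedFormula.realize_constantsVarsEquiv (v := v) (xs := default)
    (φ := (BoundedFormula.constantsVarsEquiv.symm φ : L[[C]].Formula δ))
  rw [_root_.Equiv.apply_symm_apply] at h
  exact h.symm

/-- Saturation for formulas whose parameters are named by a small type `M` mapped to `N`, and for
any finite type of variables. -/
theorem IsSaturatedIn.exists_realize {M : Type w} {N : Type y} [L.Structure N]
    {κ : Cardinal.{x}} (hN : IsSaturatedIn L N κ) (j : M → N)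
    (hκ : Cardinal.lift.{x} #M < Cardinal.lift.{w} κ) {δ : Type} [Finite δ]
    (S : Set (L.Formula (M ⊕ δ)))
    (hS : ∀ F : Finset (L.Formula (M ⊕ δ)), (F : Set (L.Formula (M ⊕ δ))) ⊆ S →
      ∃ c : δ → N, ∀ φ ∈ F, φ.Realize (Sum.elim j c)) :
    ∃ c : δ → N, ∀ φ ∈ S, φ.Realize (Sum.elim j c) := by
  classical
  obtain ⟨m, ⟨e⟩⟩ := Finite.exists_equiv_fin δ
  have hA : Cardinal.lift.{x} #(range j) < Cardinal.lift.{y} κ := by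
    have h1 : Cardinal.lift.{max w x} #(range j) ≤ Cardinal.lift.{max y x} #M := by
      have := Cardinal.lift_le.{x}.2 (mk_range_le_lift (f := j))
      simpa only [Cardinal.lift_lift, max_comm] using this
    have h2 : Cardinal.lift.{max y x} #M < Cardinal.lift.{max w y} κ := by
      have := Cardinal.lift_lt.{_, y}.2 hκ
      simpa only [Cardinal.lift_lift, max_comm] using this
    have h3 := h1.trans_lt h2
    rw [← Cardinal.lift_lt.{_, w}]
    simpa only [Cardinal.lift_lift, max_comm] using h3
  let g : L.Formula (M ⊕ δ) → L[[range j]].Formula (Fin m) := fun φ =>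
    BoundedFormula.constantsVarsEquiv.symm (φ.relabel (Sum.map (rangeFactorization j) e))
  have hg : ∀ (φ : L.Formula (M ⊕ δ)) (c : Fin m → N),
      (g φ).Realize c ↔ φ.Realize (Sum.elim j (c ∘ e)) := by
    intro φ c
    rw [Formula.realize_constantsVarsEquiv_symm, Formula.realize_relabel, Sum.elim_comp_map]
    rfl
  obtain ⟨c, hc⟩ := hN (range j) hA m (g '' S) (fun F hF => by
    obtain ⟨F', hF', rfl⟩ := Finset.subset_set_image_iff.1 hF
    obtain ⟨c, hc⟩ := hS F' hF'
    refine ⟨c ∘ e.symm, fun χ hχ => ?_⟩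
    obtain ⟨φ, hφ, rfl⟩ := Finset.mem_image.1 hχ
    rw [hg]
    simpa [Function.comp_def] using hc φ hφ)
  exact ⟨c ∘ e, fun φ hφ => (hg φ c).1 (hc _ (mem_image_of_mem g hφ))⟩

variable {M : Type w} [L.Structure M] {N : Type y} [L.Structure N]

/-- A set of tuples of `M` is externally definable if it is the trace on `M` of a set definable,
with parameters, in the elementary extension `N`. -/
def IsExternal {γ : Type} (j : M ↪ₑ[L] N) (S : Set (γ → M)) : Prop :=
  ∃ D : Set (γ → N), univ.Definable L D ∧ ∀ v : γ → M, v ∈ S ↔ j ∘ v ∈ D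

variable {j : M ↪ₑ[L] N} {α γ : Type}

theorem IsExternal.exists_formula {S : Set (γ → M)} (hS : IsExternal j S) :
    ∃ (l : ℕ) (φ : L.Formula (γ ⊕ Fin l)) (c : Fin l → N),
      ∀ v, v ∈ S ↔ φ.Realize (Sum.elim (j ∘ v) c) := by
  obtain ⟨D, hD, h⟩ := hS
  obtain ⟨l, φ, c, hφ⟩ := exists_formula_of_definable_univ hD
  exact ⟨l, φ, c, fun v => (h v).trans (hφ _)⟩

theorem IsExternal.compl {S : Set (γ → M)} (hS : IsExternal j S) : IsExternal j Sᶜ := by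
  obtain ⟨D, hD, h⟩ := hS
  exact ⟨Dᶜ, hD.compl, fun v => not_congr (h v)⟩

theorem IsExternal.inter {S T : Set (γ → M)} (hS : IsExternal j S) (hT : IsExternal j T) :
    IsExternal j (S ∩ T) := by
  obtain ⟨D, hD, h⟩ := hS
  obtain ⟨E, hE, h'⟩ := hT
  exact ⟨D ∩ E, hD.inter hE, fun v => and_congr (h v) (h' v)⟩

theorem IsExternal.preimage_comp {S : Set (γ → M)} (hS : IsExternal j S) (f : γ → α) :
    IsExternal j {v : α → M | v ∘ f ∈ S} := by
  obtain ⟨D, hD, h⟩ := hS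
  exact ⟨_, definable_preimage_relabel hD f, fun v => h (v ∘ f)⟩

/-- `Y` is a part of `X` that can be recovered from inside `M`: there is one definable family such
that each finite subset of `Y` is contained in a member of the family which is itself contained
in `X`. For `Y = X` this says that `X` has an honest definition. -/
def IsHonest (L : FirstOrder.Language.{u, v}) [L.Structure M] (X Y : Set (α → M)) : Prop :=
  ∃ (δ : Type) (_ : Finite δ) (θ : Set (α ⊕ δ → M)), univ.Definable L θ ∧
    ∀ F : Finset (α → M), (F : Set (α → M)) ⊆ Y →
      ∃ d : δ → M, (∀ a ∈ F, Sum.elim a d ∈ θ) ∧ ∀ a, Sum.elim a d ∈ θ → a ∈ X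

theorem IsHonest.empty (X : Set (α → M)) : IsHonest L X ∅ :=
  ⟨Empty, inferInstance, ∅, definable_empty, fun _ hF => ⟨Empty.elim, fun _ ha => (hF ha).elim,
    fun _ h => h.elim⟩⟩

theorem IsHonest.mono {X Y Z : Set (α → M)} (h : IsHonest L X Y) (hZ : Z ⊆ Y) :
    IsHonest L X Z := by
  obtain ⟨δ, hδ, θ, hθ, H⟩ := h
  exact ⟨δ, hδ, θ, hθ, fun F hF => H F (hF.trans hZ)⟩

theorem IsHonest.union {X Y Z : Set (α → M)} (hY : IsHonest L X Y) (hZ : IsHonest L X Z) :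
    IsHonest L X (Y ∪ Z) := by
  classical
  obtain ⟨δ, hδ, θ, hθ, H⟩ := hY
  obtain ⟨ε, hε, η, hη, H'⟩ := hZ
  refine ⟨δ ⊕ ε, inferInstance, _,
    (definable_preimage_relabel hθ (Sum.map id Sum.inl)).union
      (definable_preimage_relabel hη (Sum.map id Sum.inr)), fun F hF => ?_⟩
  obtain ⟨d, hd, hdX⟩ := H (F.filter (· ∈ Y)) (fun a ha => (Finset.mem_filter.1 ha).2)
  obtain ⟨e, he, heX⟩ := H' (F.filter (· ∈ Z)) (fun a ha => (Finset.mem_filter.1 ha).2)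
  refine ⟨Sum.elim d e, fun a ha => ?_, fun a ha => ?_⟩
  · simp only [mem_union, mem_ofPred_eq, Sum.elim_comp_map, Function.comp_id, Sum.elim_comp_inl,
      Sum.elim_comp_inr]
    exact (hF ha).imp (fun h => hd a (Finset.mem_filter.2 ⟨ha, h⟩))
      fun h => he a (Finset.mem_filter.2 ⟨ha, h⟩)
  · simp only [mem_union, mem_ofPred_eq, Sum.elim_comp_map, Function.comp_id, Sum.elim_comp_inl,
      Sum.elim_comp_inr] at ha
    exact ha.elim (hdX a) (heX a)

/-- Under NIP, externally definable sets have honest definitions. Otherwise some ultrafilter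
contains `X` but no `Y` that is honest for `X`, and then tuples with any prescribed pattern can be
chosen, the first coordinate being chosen last: failure of honesty produces finitely many
conditions on the other coordinates which leave room for a first coordinate outside `X`. -/
theorem IsExternal.isHonest [Finite α] (hM : HasNIP L M) {X : Set (α → M)} (hX : IsExternal j X) :
    IsHonest L X X := by
  classical
  by_contra hnot
  obtain ⟨l, φ, c, hφ⟩ := hX.exists_formula
  -- The sets `Y` that are honest for `X` form an ideal, not containing `X`; `G` is the dual filter.
  let G : Filter (α → M) := Filter.comk (IsHonest L X) (IsHonest.empty X)
    (fun _ ht _ hs => ht.mono hs) fun _ hs _ ht => hs.union ht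
  have hG : NeBot (G ⊓ 𝓟 X) := by
    rw [inf_principal_neBot_iff]
    intro U hU
    by_contra hne
    rw [not_nonempty_iff_eq_empty] at hne
    refine hnot (IsHonest.mono (mem_comk.1 hU) fun a ha haU => ?_)
    exact (eq_empty_iff_forall_notMem.1 hne a) ⟨haU, ha⟩
  obtain ⟨R, hR⟩ := Ultrafilter.exists_le (G ⊓ 𝓟 X)
  have hRX : ∀ᶠ a in R, a ∈ X := hR (mem_inf_of_right (mem_principal_self X))
  have hRG : ∀ Y : Set (α → M), (∀ᶠ a in R, a ∈ Y) → ¬ IsHonest L X Y := by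
    intro Y hY hh
    have h1 : Yᶜ ∈ R := hR (mem_inf_of_left (mem_comk.2 (by rwa [compl_compl])))
    exact Ultrafilter.compl_mem_iff_notMem.1 h1 hY
  obtain ⟨k, hk⟩ := hM.exists_not_shatters φ
  refine Exists.elim (exists_shatters_of_ultrafilter j φ c R (fun k => ?_) k) hk
  simp only [← hφ]
  induction k with
  | zero =>
    intro Θ _ h s
    exact ⟨Fin.elim0, h, fun i => i.elim0⟩
  | succ k ih =>
    intro Θ hΘ h s
    let f : Fin (k + 1) × α → α ⊕ (Fin k × α) := fun z =>
        Fin.cases (Sum.inl z.2) (fun i => Sum.inr (i, z.2)) z.1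
    have hf : ∀ (a : α → M) (v : Fin k → α → M),
        Sum.elim a (fun z : Fin k × α => v z.1 z.2) ∘ f =
          fun z => (Fin.cons a v : Fin (k + 1) → α → M) z.1 z.2 := by
      intro a v
      ext ⟨i, t⟩
      refine Fin.cases ?_ (fun i => ?_) i <;> rfl
    have hΘ' := definable_preimage_relabel hΘ f
    rw [Ultrafilter.eventually_pow_succ] at h
    simp only [← hf] at h
    let Y : Set (α → M) := {a | ∀ᶠ v : Fin k → α → M in R.pow k,
      Sum.elim a (fun z : Fin k × α => v z.1 z.2) ∘ f ∈ Θ}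
    by_cases h0 : (0 : Fin (k + 1)) ∈ s
    · obtain ⟨a, haY, haX⟩ := (h.and hRX).exists
      obtain ⟨v, hv, hvs⟩ := ih _ (definable_fibre hΘ' a) haY {i | i.succ ∈ s}
      refine ⟨Fin.cons a v, ?_, Fin.cases (iff_of_true haX h0) hvs⟩
      rw [← hf]
      exact hv
    · -- `Y` is large for `R`, so not honest for `X`: it has a finite subset `F` such that every
      -- fibre of `Θ` containing `F` has a point outside `X`.
      have hY := hRG Y h
      simp only [IsHonest, not_exists, not_and, not_forall] at hY
      obtain ⟨F, hFY, hF⟩ := hY (Fin k × α) inferInstance _ hΘ'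
      have hdef := definable_biInter_finset (fun a => definable_fibre hΘ' a) F
      obtain ⟨v, hv, hvs⟩ := ih _ hdef (by
        simp only [mem_iInter]
        exact (eventually_all_finset F).2 fun a ha => hFY ha) {i | i.succ ∈ s}
      simp only [mem_iInter] at hv
      obtain ⟨a, ha, haX⟩ := hF _ hv
      refine ⟨Fin.cons a v, ?_, Fin.cases (iff_of_false haX h0) hvs⟩
      rw [← hf]
      exact ha

/-- Shelah's theorem: under NIP, and with `N` saturated enough, the projection of an externally
definable set is externally definable. If `θ(x, y; z)` is an honest definition of `X`, the projection
of `X` is defined by `∃ y, θ(x, y; d)` for a realization `d` in `N` of the set of conditions stating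
just that; finitely many of these conditions are satisfied by a tuple `d` of `M`, and then the
witnesses `y` for `x` in `M` may be taken in `M`. -/
theorem IsExternal.exists_of_finite [Nonempty M] {κ : Cardinal.{x}} (hN : IsSaturatedIn L N κ)
    (hκ : Cardinal.lift.{x} #M < Cardinal.lift.{w} κ) (hM : HasNIP L M) [Finite α] [Finite γ]
    {X : Set (α ⊕ γ → M)} (hX : IsExternal j X) :
    IsExternal j {a : α → M | ∃ b : γ → M, Sum.elim a b ∈ X} := by
  classical
  obtain ⟨δ, hδ, θ, hθ, H⟩ := hX.isHonest hM
  have hπ := (definable_preimage_relabel hθ (Sum.elim (Sum.elim (Sum.inl ∘ Sum.inl) Sum.inr)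
    (Sum.inl ∘ Sum.inr) : (α ⊕ γ) ⊕ δ → (α ⊕ δ) ⊕ γ)).exists_of_finite
  obtain ⟨ψ, hψ⟩ := definable_univ_iff_exists_formula.1 hπ
  have hψ' : ∀ (a : α → M) (d : δ → M), ψ.Realize (Sum.elim id (Sum.elim a d)) ↔
      ∃ b : γ → M, Sum.elim (Sum.elim a b) d ∈ θ := by
    intro a d
    rw [← hψ]
    refine exists_congr fun b => iff_of_eq (congrArg (· ∈ θ) ?_)
    ext ((_ | _) | _) <;> rfl
  set π : Set (α → M) := {a : α → M | ∃ b : γ → M, Sum.elim a b ∈ X}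
  let g : (α → M) → L.Formula (M ⊕ δ) := fun a =>
    ψ.relabel (Sum.elim Sum.inl (Sum.elim (Sum.inl ∘ a) Sum.inr))
  have hg : ∀ (a : α → M) (d : δ → N), (g a).Realize (Sum.elim j d) ↔
      ψ.Realize (Sum.elim j (Sum.elim (j ∘ a) d)) := by
    intro a d
    rw [Formula.realize_relabel]
    refine iff_of_eq (congrArg _ ?_)
    ext (_ | _ | _) <;> rfl
  let h : (α → M) → L.Formula (M ⊕ δ) := fun a => if a ∈ π then g a else ∼(g a)
  obtain ⟨d, hd⟩ := hN.exists_realize j hκ (range h) (fun F hF => by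
    obtain ⟨F, rfl⟩ : ∃ F' : Finset (α → M), F'.image h = F := by
      rw [← image_univ] at hF
      obtain ⟨F', -, h⟩ := Finset.subset_set_image_iff.1 hF
      exact ⟨F', h⟩
    -- For each `a` of the projection in `F`, choose a point of `X` above it.
    choose! w hw using fun (a : α → M) (ha : a ∈ π) => ha
    obtain ⟨d, hd, hdX⟩ := H ((F.filter (· ∈ π)).image fun a => Sum.elim a (w a)) (by
      intro z hz
      obtain ⟨a, ha, rfl⟩ := Finset.mem_image.1 hz
      exact hw a (Finset.mem_filter.1 ha).2)
    refine ⟨j ∘ d, fun χ hχ => ?_⟩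
    obtain ⟨a, ha, rfl⟩ := Finset.mem_image.1 hχ
    have hiff : (g a).Realize (Sum.elim j (j ∘ d)) ↔ ∃ b : γ → M, Sum.elim (Sum.elim a b) d ∈ θ := by
      rw [hg, ← Sum.comp_elim, j.realize_elim, hψ']
    by_cases haπ : a ∈ π
    · simp only [h, if_pos haπ]
      exact hiff.2 ⟨w a, hd _ (Finset.mem_image.2 ⟨a, Finset.mem_filter.2 ⟨ha, haπ⟩, rfl⟩)⟩
    · simp only [h, if_neg haπ, Formula.realize_not, hiff]
      rintro ⟨b, hb⟩
      exact haπ ⟨b, hdX _ hb⟩)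
  refine ⟨_, definable_fibre (definable_preimage_relabel
    (definable_univ_of_formula (ψ.relabel (Sum.map j id))) Sum.swap) d, fun a => ?_⟩
  have h1 := hd _ ⟨a, rfl⟩
  have h2 : Sum.elim d (j ∘ a) ∘ Sum.swap = Sum.elim (j ∘ a) d := by
    ext (_ | _) <;> rfl
  change a ∈ π ↔ (ψ.relabel (Sum.map j id)).Realize (Sum.elim id (Sum.elim d (j ∘ a) ∘ Sum.swap))
  rw [h2, Formula.realize_relabel, Sum.elim_comp_map]
  change _ ↔ ψ.Realize (Sum.elim j (Sum.elim (j ∘ a) d))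
  rw [← hg]
  by_cases haπ : a ∈ π
  · simp only [h, if_pos haπ] at h1
    exact iff_of_true haπ h1
  · simp only [h, if_neg haπ, Formula.realize_not] at h1
    exact iff_of_false haπ h1

end External

end FirstOrder.Language

/-! ### Transfer to elementary extensions -/

namespace FirstOrder.Language

section Transfer

variable {L : FirstOrder.Language.{u, v}} {M : Type w} [L.Structure M] {n : ℕ}
  {P R : Ultrafilter (Fin n → M)} {N : Type y} [L.Structure N] {j : M ↪ₑ[L] N}

/-- The sentence saying that `φ` shatters some `k` tuples. -/
noncomputable def Formula.shatterSentence {α β : Type} [Finite α] [Finite β]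
    (φ : L.Formula (α ⊕ β)) (k : ℕ) : L.Sentence :=
  Formula.iExs (α := Empty) (Fin k × α)
    (Formula.relabel Sum.inr (Formula.iInf fun s : Set (Fin k) => φ.pattern s))

theorem Formula.realize_shatterSentence {α β : Type} [Finite α] [Finite β]
    (φ : L.Formula (α ⊕ β)) (k : ℕ) {K : Type*} [L.Structure K] :
    K ⊨ φ.shatterSentence k ↔ ∃ a : Fin k → α → K, φ.Shatters a := by
  refine Formula.realize_iExs.trans ⟨fun ⟨v, hv⟩ => ⟨fun i t => v (i, t), ?_⟩,
    fun ⟨a, ha⟩ => ⟨fun z => a z.1 z.2, ?_⟩⟩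
  · rw [Formula.realize_relabel, Formula.realize_iInf] at hv
    exact (φ.shatters_iff _).2 hv
  · rw [Formula.realize_relabel, Formula.realize_iInf]
    exact (φ.shatters_iff a).1 ha

/-- NIP for a theory speaks of its models in one universe; as shattering is expressed by a sentence,
it holds in all models. -/
theorem Theory.IsNIP.hasNIP {T : L.Theory} (hT : T.IsNIP) [Nonempty M] (hM : M ⊨ T) :
    HasNIP L M := by
  intro m l φ
  obtain ⟨k, hk⟩ := hT m l φ
  refine ⟨k, fun a ha => ?_⟩
  have hT' : T ⊨ᵇ (φ.shatterSentence k).not := by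
    rw [Theory.models_sentence_iff]
    intro K
    rw [Sentence.realize_not, Formula.realize_shatterSentence]
    rintro ⟨a, ha⟩
    exact hk K a ha
  have h := hT'.realize_sentence M
  rw [Sentence.realize_not, Formula.realize_shatterSentence] at h
  exact h ⟨a, ha⟩

theorem IsDefinableAndCovered.exists_formula (hP : IsDefinableAndCovered L P) (hM : HasNIP L M)
    (j : M ↪ₑ[L] N) {γ : Type} [Finite γ] (φ : L.Formula (γ ⊕ Fin n)) :
    ∃ d : L.Formula (M ⊕ γ),
      (∀ b : γ → M, d.Realize (Sum.elim id b) ↔ ∀ᶠ a in P, φ.Realize (Sum.elim b a)) ∧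
      ∀ c : γ → N, d.Realize (Sum.elim j c) ↔ ∀ᶠ a in P, φ.Realize (Sum.elim c (j ∘ a)) := by
  have hφ : univ.Definable L {v : γ ⊕ Fin n → M | φ.Realize v} :=
    definable_univ_iff_exists_formula.2 ⟨φ.relabel Sum.inr, fun v => by
      rw [Formula.realize_relabel]; rfl⟩
  obtain ⟨d, hd⟩ := definable_univ_iff_exists_formula.1 (hP.definable _ hφ)
  exact ⟨d, fun b => (hd b).symm, hP.realize_iff_eventually hM j φ d fun b => (hd b).symm⟩

theorem IsExternal.exists_formula_sum {γ : Type} {S : Set (γ ⊕ Fin n → M)} (hS : IsExternal j S) :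
    ∃ (l : ℕ) (φ : L.Formula ((Fin l ⊕ γ) ⊕ Fin n)) (c : Fin l → N), ∀ b a,
      Sum.elim b a ∈ S ↔ φ.Realize (Sum.elim (Sum.elim c (j ∘ b)) (j ∘ a)) := by
  obtain ⟨l, φ, c, hφ⟩ := hS.exists_formula
  refine ⟨l, φ.relabel (Sum.elim (Sum.map Sum.inr id) (Sum.inl ∘ Sum.inl)), c, fun b a => ?_⟩
  rw [hφ, Formula.realize_relabel]
  refine iff_of_eq (congrArg _ ?_)
  ext ((_ | _) | _) <;> rfl

/-- A definable and covered ultrafilter is definable for externally definable families too: the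
definition is applied to the external parameters. -/
theorem IsDefinableAndCovered.definable_external (hP : IsDefinableAndCovered L P)
    (hM : HasNIP L M) {γ : Type} [Finite γ] {S : Set (γ ⊕ Fin n → M)} (hS : IsExternal j S) :
    IsExternal j {b : γ → M | ∀ᶠ a in P, Sum.elim b a ∈ S} := by
  obtain ⟨l, φ, c, hφ⟩ := hS.exists_formula_sum
  obtain ⟨d, -, hd⟩ := hP.exists_formula hM j φ
  refine ⟨_, definable_fibre (definable_univ_of_formula (d.relabel (Sum.map j id))) c,
    fun b => ?_⟩
  simp only [mem_ofPred_eq, Formula.realize_relabel, Sum.elim_comp_map, Function.comp_id]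
  change _ ↔ d.Realize (Sum.elim j (Sum.elim c (j ∘ b)))
  simp only [hd, hφ]

theorem IsDefinableAndCovered.cover_external (hP : IsDefinableAndCovered L P)
    (hM : HasNIP L M) {γ : Type} [Finite γ] {S : Set (γ ⊕ Fin n → M)} (hS : IsExternal j S) :
    ∃ F : Finset (Fin n → M), ∀ b : γ → M, (∀ᶠ a in P, Sum.elim b a ∈ S) →
      ∃ a ∈ F, Sum.elim b a ∈ S := by
  obtain ⟨l, φ, c, hφ⟩ := hS.exists_formula_sum
  obtain ⟨d, hd, hd'⟩ := hP.exists_formula hM j φ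
  obtain ⟨F, hF⟩ := hP.exists_finset_cover j (φ.relabel Sum.inr) d fun b hb =>
    ((hd b).1 hb).mono fun a ha => by
      rw [Formula.realize_relabel]
      exact ha
  refine ⟨F, fun b hb => ?_⟩
  simp only [hφ] at hb ⊢
  obtain ⟨a, haF, ha⟩ := hF _ ((hd' _).2 hb)
  rw [Formula.realize_relabel] at ha
  exact ⟨a, haF, ha⟩

/-- Two definable and covered ultrafilters inducing the same type over `M` induce the same type
over each elementary extension. -/
theorem IsDefinableAndCovered.eventually_congr (hP : IsDefinableAndCovered L P)
    (hR : IsDefinableAndCovered L R) (hM : HasNIP L M) (j : M ↪ₑ[L] N)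
    (hPR : ∀ S : Set (Fin n → M), univ.Definable L S → ((∀ᶠ a in P, a ∈ S) ↔ ∀ᶠ a in R, a ∈ S))
    {D : Set (Fin n → N)} (hD : univ.Definable L D) :
    (∀ᶠ a in P, j ∘ a ∈ D) ↔ ∀ᶠ a in R, j ∘ a ∈ D := by
  obtain ⟨l, φ, c, hφ⟩ := exists_formula_of_definable_univ hD
  obtain ⟨d, hd, hd'⟩ := hP.exists_formula hM j (φ.relabel Sum.swap)
  have h2 := hR.realize_iff_eventually hM j (φ.relabel Sum.swap) d (fun b => by
    rw [hd]
    exact hPR {a | (φ.relabel Sum.swap).Realize (Sum.elim b a)} (definable_fibre (definable_univ_iff_exists_formula.2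
      ⟨(φ.relabel Sum.swap).relabel Sum.inr, fun v => by rw [Formula.realize_relabel]; rfl⟩) b)) c
  have hswap : ∀ a : Fin n → M, j ∘ a ∈ D ↔
      (φ.relabel Sum.swap).Realize (Sum.elim c (j ∘ a)) := by
    intro a
    rw [hφ, Formula.realize_relabel]
    refine iff_of_eq (congrArg _ ?_)
    ext (_ | _) <;> rfl
  simp only [hswap]
  rw [← hd', h2]

end Transfer

/-! ### Quantifier elimination in the Shelah expansion -/

section QuantifierElimination

variable {L : FirstOrder.Language.{u, v}} {M : Type x} [L.Structure M] {N : Type w} [L.Structure N]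
  (j : M ↪ₑ[L] N)

/-- The elementary embedding of the `L`-reduct of the Shelah expansion. -/
def ShelahExpansion.embedding : ShelahExpansion j ↪ₑ[L] N := j

instance [h : Nonempty M] : Nonempty (ShelahExpansion j) := h

variable {j} {γ : Type}

/-- The Shelah language has no new function symbols, so its terms are interpreted by `L`-terms. -/
theorem ShelahExpansion.exists_term {k : ℕ}
    (t : (shelahLanguage L N).Term ((ShelahExpansion j ⊕ γ) ⊕ Fin k)) :
    ∃ t' : L.Term (N ⊕ (γ ⊕ Fin k)), ∀ v : γ ⊕ Fin k → ShelahExpansion j,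
      embedding j (t.realize (Sum.elim (Sum.elim id (v ∘ Sum.inl)) (v ∘ Sum.inr))) =
        t'.realize (Sum.elim id (embedding j ∘ v)) := by
  induction t with
  | var z =>
    rcases z with (m | g) | i
    · exact ⟨Term.var (Sum.inl (embedding j m)), fun v => rfl⟩
    · exact ⟨Term.var (Sum.inr (Sum.inl g)), fun v => rfl⟩
    · exact ⟨Term.var (Sum.inr (Sum.inr i)), fun v => rfl⟩
  | func f ts ih =>
    choose ts' h using ih
    rcases f with f | f
    · refine ⟨Term.func f ts', fun v => ?_⟩
      simp only [Term.realize_func, ← h]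
      exact (embedding j).map_fun f _
    · exact PEmpty.elim f

/-- Quantifier elimination: every set defined in the Shelah expansion is externally definable in
`L`. The quantifier step is the closure of external sets under projections. -/
theorem ShelahExpansion.isExternal_boundedFormula [Nonempty M] {κ : Cardinal.{z}}
    (hN : IsSaturatedIn L N κ) (hκ : Cardinal.lift.{z} #M < Cardinal.lift.{x} κ)
    (hM : HasNIP L (ShelahExpansion j)) [Finite γ] {k : ℕ}
    (ψ : (shelahLanguage L N).BoundedFormula (ShelahExpansion j ⊕ γ) k) :
    IsExternal (embedding j)
      {v : γ ⊕ Fin k → ShelahExpansion j | ψ.Realize (Sum.elim id (v ∘ Sum.inl)) (v ∘ Sum.inr)} := by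
  induction ψ with
  | falsum => exact ⟨∅, definable_empty, fun v => Iff.rfl⟩
  | equal t₁ t₂ =>
    obtain ⟨t₁', h₁⟩ := exists_term t₁
    obtain ⟨t₂', h₂⟩ := exists_term t₂
    refine ⟨_, definable_univ_of_formula (t₁'.equal t₂'), fun v => ?_⟩
    rw [mem_ofPred_eq, mem_ofPred_eq, Formula.realize_equal, ← h₁, ← h₂,
      (embedding j).injective.eq_iff]
    rfl
  | rel R ts =>
    choose ts' h using fun i => exists_term (ts i)
    rcases R with R | R
    · refine ⟨_, definable_univ_of_formula (R.formula ts'), fun v => ?_⟩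
      rw [mem_ofPred_eq, mem_ofPred_eq, Formula.realize_rel]
      simp only [← h]
      exact ((embedding j).map_rel R _).symm
    · refine ⟨_, definable_univ_of_formula (BoundedFormula.subst
        (BoundedFormula.constantsVarsEquiv R) (Sum.elim (Term.var ∘ Sum.inl) ts')), fun v => ?_⟩
      rw [mem_ofPred_eq, mem_ofPred_eq, Formula.Realize, BoundedFormula.realize_subst]
      refine Iff.trans (BoundedFormula.realize_constantsVarsEquiv (M := N)).symm ?_
      refine iff_of_eq (congrArg (BoundedFormula.Realize _ · _) ?_)
      ext (c | i)
      · rfl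
      · exact h i v
  | imp φ₁ φ₂ ih₁ ih₂ =>
    convert (ih₁.inter ih₂.compl).compl using 1
    ext v
    simp
  | @all k φ ih =>
    let f : γ ⊕ Fin (k + 1) → (γ ⊕ Fin k) ⊕ Unit :=
      Sum.elim (Sum.inl ∘ Sum.inl) (Fin.snoc (fun i => Sum.inl (Sum.inr i)) (Sum.inr ()))
    refine (congrArg (IsExternal (embedding j)) ?_).mpr
      ((ih.preimage_comp f).compl.exists_of_finite hN hκ hM).compl
    ext v
    have hf : ∀ (b : Unit → ShelahExpansion j),
        (Sum.elim v b ∘ f) ∘ Sum.inl = v ∘ Sum.inl ∧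
          (Sum.elim v b ∘ f) ∘ Sum.inr = Fin.snoc (v ∘ Sum.inr) (b ()) := by
      intro b
      refine ⟨rfl, ?_⟩
      ext i
      refine Fin.lastCases ?_ (fun i => ?_) i <;> simp [f]
    change (∀ x, φ.Realize (Sum.elim id (v ∘ Sum.inl)) (Fin.snoc (v ∘ Sum.inr) x)) ↔
      ¬ ∃ b : Unit → ShelahExpansion j, ¬ φ.Realize
        (Sum.elim id ((Sum.elim v b ∘ f) ∘ Sum.inl)) ((Sum.elim v b ∘ f) ∘ Sum.inr)
    simp only [not_exists, not_not, (hf _).1, (hf _).2]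
    exact ⟨fun h b => h (b ()), fun h a => h fun _ => a⟩

theorem ShelahExpansion.isExternal_of_definable [Nonempty M] {κ : Cardinal.{z}}
    (hN : IsSaturatedIn L N κ) (hκ : Cardinal.lift.{z} #M < Cardinal.lift.{x} κ)
    (hM : HasNIP L (ShelahExpansion j)) [Finite γ] {S : Set (γ → ShelahExpansion j)}
    (hS : univ.Definable (shelahLanguage L N) S) : IsExternal (embedding j) S := by
  obtain ⟨ψ, hψ⟩ := definable_univ_iff_exists_formula.1 hS
  convert (isExternal_boundedFormula hN hκ hM ψ).preimage_comp (Sum.elim id Fin.elim0) using 1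
  ext v
  rw [hψ, mem_ofPred_eq, mem_ofPred_eq, Formula.Realize]
  refine iff_of_eq (congrArg (BoundedFormula.Realize _ _) (Subsingleton.elim _ _))

/-- An externally definable set is given by a relation symbol of the Shelah language, without
parameters from `M`. -/
theorem ShelahExpansion.exists_formula_of_isExternal [Finite γ] {S : Set (γ → ShelahExpansion j)}
    (hS : IsExternal (embedding j) S) :
    ∃ δ : (shelahLanguage L N).Formula γ, ∀ v, δ.Realize v ↔ v ∈ S := by
  obtain ⟨m, ⟨e⟩⟩ := Finite.exists_equiv_fin γ
  obtain ⟨D, hD, hDS⟩ := hS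
  obtain ⟨φ, hφ⟩ := definable_univ_iff_exists_formula.1 hD
  let χ : L[[N]].Formula (Fin m) :=
    BoundedFormula.constantsVarsEquiv.symm (φ.relabel (Sum.map id e))
  let R : (externalLanguage L N).Relations m := χ
  refine ⟨Relations.formula (L := shelahLanguage L N) (Sum.inr R) fun i => Term.var (e.symm i),
    fun v => ?_⟩
  refine Formula.realize_rel.trans ?_
  rw [hDS, hφ]
  change χ.Realize (fun i => embedding j (v (e.symm i))) ↔ _
  rw [Formula.realize_constantsVarsEquiv_symm, Formula.realize_relabel, Sum.elim_comp_map]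
  refine iff_of_eq (congrArg _ ?_)
  ext (_ | _)
  · rfl
  · simp

/-- A formula of the Shelah language that shatters `k` tuples of `M` yields an `L`-formula shattering
the same tuples in `N`. -/
theorem ShelahExpansion.hasNIP [Nonempty M] {κ : Cardinal.{z}}
    (hN : IsSaturatedIn L N κ) (hκ : Cardinal.lift.{z} #M < Cardinal.lift.{x} κ)
    (hM : HasNIP L (ShelahExpansion j)) (hN' : HasNIP L N) :
    HasNIP (shelahLanguage L N) (ShelahExpansion j) := by
  intro m l φ
  obtain ⟨r, ψ, c, hψ⟩ := (isExternal_of_definable hN hκ hM (definable_univ_of_formula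
    (L := shelahLanguage L N) (M := ShelahExpansion j) (φ.relabel Sum.inr))).exists_formula
  obtain ⟨k, hk⟩ := hN'.exists_not_shatters (ψ.relabel (_root_.Equiv.sumAssoc _ _ _))
  refine ⟨k, fun a ha => hk (fun i => embedding j ∘ a i) fun s => ?_⟩
  obtain ⟨b, hb⟩ := ha s
  refine ⟨Sum.elim (embedding j ∘ b) c, fun i => ?_⟩
  rw [← hb, Formula.realize_relabel]
  have h := hψ (Sum.elim (a i) b)
  rw [mem_ofPred_eq, Formula.realize_relabel] at h
  refine Iff.trans ?_ h.symm
  refine iff_of_eq (congrArg _ ?_)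
  ext ((_ | _) | _) <;> rfl

theorem IsDefinableAndCovered.shelahExpansion [Nonempty M] {κ : Cardinal.{z}}
    (hN : IsSaturatedIn L N κ) (hκ : Cardinal.lift.{z} #M < Cardinal.lift.{x} κ)
    (hM : HasNIP L (ShelahExpansion j)) {n : ℕ} {P : Ultrafilter (Fin n → ShelahExpansion j)}
    (hP : IsDefinableAndCovered L P) : IsDefinableAndCovered (shelahLanguage L N) P where
  definable S hS := by
    obtain ⟨δ, hδ⟩ := ShelahExpansion.exists_formula_of_isExternal
      (hP.definable_external hM (ShelahExpansion.isExternal_of_definable hN hκ hM hS))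
    refine definable_univ_iff_exists_formula.2 ⟨δ.relabel Sum.inr, fun v => ?_⟩
    rw [← hδ, Formula.realize_relabel]
    rfl
  cover S hS := hP.cover_external hM (ShelahExpansion.isExternal_of_definable hN hκ hM hS)

end QuantifierElimination

end FirstOrder.Language

/-! ### Global types as limits of ultrafilters -/

namespace FirstOrder.Language

section Reduct

variable {L L' : FirstOrder.Language} {M : Type x} [L.Structure M] [L'.Structure M]
  {U : Type w} [L.Structure U] [L'.Structure U]

/-- An elementary embedding for a language is elementary for each reduct. -/
def ElementaryEmbedding.reduct (f : L →ᴸ L') [f.IsExpansionOn M] [f.IsExpansionOn U]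
    (i : M ↪ₑ[L'] U) : M ↪ₑ[L] U where
  toFun := i
  map_formula' _ φ a := by
    rw [← f.realize_onFormula, i.map_formula, f.realize_onFormula]

theorem IsSaturatedIn.reduct (f : L →ᴸ L') [f.IsExpansionOn U] {κ : Cardinal.{z}}
    (hU : IsSaturatedIn L' U κ) :
    IsSaturatedIn L U κ := by
  classical
  intro A hA n S hS
  obtain ⟨c, hc⟩ := hU A hA n ((f.addConstants A).onFormula '' S) (fun F hF => by
    obtain ⟨F', hF', rfl⟩ := Finset.subset_set_image_iff.1 hF
    obtain ⟨c, hc⟩ := hS F' hF'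
    refine ⟨c, fun χ hχ => ?_⟩
    obtain ⟨φ, hφ, rfl⟩ := Finset.mem_image.1 hχ
    exact ((f.addConstants A).realize_onFormula φ).2 (hc φ hφ))
  exact ⟨c, fun φ hφ => ((f.addConstants A).realize_onFormula φ).1 (hc _ (mem_image_of_mem _ hφ))⟩

end Reduct

theorem ElementaryEmbedding.exists_elementarySubstructure_eq_range {L : FirstOrder.Language}
    {M : Type x} [L.Structure M] {U : Type w} [L.Structure U] (i : M ↪ₑ[L] U) :
    ∃ S : L.ElementarySubstructure U, (S : Set U) = range i := by
  refine ⟨⟨i.toEmbedding.toHom.range, fun k φ a => ?_⟩, ?_⟩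
  · obtain ⟨b, rfl⟩ : ∃ b : Fin k → M, i.toEmbedding.equivRange ∘ b = a :=
      ⟨i.toEmbedding.equivRange.symm ∘ a,
        funext fun t => i.toEmbedding.equivRange.toEquiv.apply_symm_apply (a t)⟩
    rw [StrongHomClass.realize_formula]
    exact i.map_formula φ b
  · exact Hom.range_coe _

namespace GlobalType

variable {L : FirstOrder.Language.{u, v}} {U : Type w} [L.Structure U] {n : ℕ}

theorem ext_of_has {p q : GlobalType L U n} (h : ∀ φ, p.Has φ ↔ q.Has φ) : p = q := by
  refine SetLike.ext fun σ => ?_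
  obtain ⟨φ, rfl⟩ := Formula.equivSentence.surjective σ
  exact h φ

theorem has_not (p : GlobalType L U n) (φ : L[[U]].Formula (Fin n)) :
    p.Has (∼φ) ↔ ¬ p.Has φ :=
  p.not_mem_iff (Formula.equivSentence φ)

theorem Has.inf {p : GlobalType L U n} {φ ψ : L[[U]].Formula (Fin n)} (hφ : p.Has φ)
    (hψ : p.Has ψ) : p.Has (φ ⊓ ψ) := by
  have h : ∀ σ τ : (L[[U]])[[Fin n]].Sentence, σ ∈ p → τ ∈ p → σ ⊓ τ ∈ p := by
    intro σ τ hσ hτ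
    have hmem := fun ρ => p.isMaximal.mem_iff_models ρ
    refine (hmem _).2 (Theory.models_sentence_iff.2 fun K => ?_)
    exact BoundedFormula.realize_inf.2 ⟨Theory.models_sentence_iff.1 ((hmem σ).1 hσ) K,
      Theory.models_sentence_iff.1 ((hmem τ).1 hτ) K⟩
  exact h _ _ hφ hψ

theorem IsDefinableOver.mono {p : GlobalType L U n} {A B : Set U} (h : p.IsDefinableOver A)
    (hAB : A ⊆ B) : p.IsDefinableOver B :=
  fun m φ => (h m φ).mono hAB

theorem IsFinitelySatisfiableIn.mono {p : GlobalType L U n} {A B : Set U}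
    (h : p.IsFinitelySatisfiableIn A) (hAB : A ⊆ B) : p.IsFinitelySatisfiableIn B :=
  fun φ hφ => (h φ hφ).imp fun _ ha => ⟨fun k => hAB (ha.1 k), ha.2⟩

theorem IsExtendedBy.has_iff_eventually {L' : FirstOrder.Language} [L'.Structure U] {f : L →ᴸ L'}
    [f.IsExpansionOn U] {p : GlobalType L U n} {q : GlobalType L' U n} (hpq : p.IsExtendedBy f q)
    {M : Type x} {e : M → U} {P : Ultrafilter (Fin n → M)}
    (hq : ∀ φ, q.Has φ ↔ ∀ᶠ a in P, φ.Realize (e ∘ a)) (φ : L[[U]].Formula (Fin n)) :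
    p.Has φ ↔ ∀ᶠ a in P, φ.Realize (e ∘ a) := by
  have h : p.Has φ ↔ q.Has ((f.addConstants U).onFormula φ) := by
    refine ⟨hpq φ, fun h => ?_⟩
    by_contra hφ
    exact (q.has_not _).1 (hpq _ ((p.has_not φ).2 hφ)) h
  rw [h, hq]
  simp only [LHom.realize_onFormula]

theorem realize_inst {m : ℕ} (φ : L.Formula (Fin m ⊕ Fin n)) (b : Fin m → U) (a : Fin n → U) :
    (inst φ b).Realize a ↔ φ.Realize (Sum.elim b a) := by
  rw [inst, Formula.realize_constantsVarsEquiv_symm, Formula.realize_relabel, Sum.elim_comp_map]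
  rfl

theorem definable_univ_realize (ψ : L[[U]].Formula (Fin n)) :
    univ.Definable L {a : Fin n → U | ψ.Realize a} :=
  definable_univ_iff_exists_formula.2 ⟨BoundedFormula.constantsVarsEquiv ψ, fun _ =>
    (BoundedFormula.realize_constantsVarsEquiv (M := U)).symm⟩

/-- The limit of an ultrafilter on tuples: the type of the formulas true of almost all tuples. -/
def ofUltrafilter [Nonempty U] (Q : Ultrafilter (Fin n → U)) : GlobalType L U n where
  toTheory := {σ | ∀ᶠ a : Fin n → U in Q, σ ∈ (L.elementaryDiagram U).typeOf a}
  subset' σ hσ := Eventually.of_forall fun a => ((L.elementaryDiagram U).typeOf a).subset hσ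
  isMaximal' := by
    refine ⟨Theory.isSatisfiable_iff_isFinitelySatisfiable.2 fun T₀ hT₀ => ?_, fun σ => ?_⟩
    · have h : ∀ᶠ a : Fin n → U in Q, ∀ σ ∈ T₀, σ ∈ (L.elementaryDiagram U).typeOf a :=
        (eventually_all_finset T₀).2 fun σ hσ => hT₀ hσ
      obtain ⟨a, ha⟩ := h.exists
      exact ((L.elementaryDiagram U).typeOf a).isMaximal.1.mono ha
    · refine (Q.em _).imp_right fun h => h.mono fun a ha => ?_
      exact (Theory.CompleteType.not_mem_iff _ _).2 ha

theorem has_ofUltrafilter [Nonempty U] (Q : Ultrafilter (Fin n → U)) (φ : L[[U]].Formula (Fin n)) :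
    (ofUltrafilter (L := L) Q).Has φ ↔ ∀ᶠ a : Fin n → U in Q, φ.Realize a := by
  change (∀ᶠ a : Fin n → U in Q, Formula.equivSentence φ ∈ (L.elementaryDiagram U).typeOf a) ↔ _
  simp only [Theory.CompleteType.formula_mem_typeOf]

/-- A type finitely satisfiable in the image of `A` is the limit of an ultrafilter on the tuples
from `A`. -/
theorem IsFinitelySatisfiableIn.exists_ultrafilter {M : Type x} {e : M → U} {A : Set M}
    {p : GlobalType L U n} (hp : p.IsFinitelySatisfiableIn (e '' A)) :
    ∃ P : Ultrafilter (Fin n → M), (∀ᶠ a : Fin n → M in P, ∀ k, a k ∈ A) ∧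
      ∀ φ, p.Has φ ↔ ∀ᶠ a in P, φ.Realize (e ∘ a) := by
  let S : {φ // p.Has φ} → Set (Fin n → M) := fun φ =>
    {a | (∀ k, a k ∈ A) ∧ φ.1.Realize (e ∘ a)}
  have htop : p.Has ⊤ := by
    by_contra h
    obtain ⟨a, -, ha⟩ := hp _ ((p.has_not ⊤).2 h)
    exact Formula.realize_not.1 ha (Formula.realize_top.2 trivial)
  have : Nonempty {φ // p.Has φ} := ⟨⟨⊤, htop⟩⟩
  have hne : NeBot (⨅ φ, 𝓟 (S φ)) := by
    refine iInf_neBot_of_directed' (fun φ ψ => ⟨⟨φ.1 ⊓ ψ.1, φ.2.inf ψ.2⟩, ?_, ?_⟩) fun φ => ?_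
    · exact principal_mono.2 fun a ha => ⟨ha.1, (Formula.realize_inf.1 ha.2).1⟩
    · exact principal_mono.2 fun a ha => ⟨ha.1, (Formula.realize_inf.1 ha.2).2⟩
    · rw [principal_neBot_iff]
      obtain ⟨a, haA, ha⟩ := hp φ.1 φ.2
      choose b hbA hb using haA
      obtain rfl : e ∘ b = a := funext hb
      exact ⟨b, hbA, ha⟩
  obtain ⟨P, hP⟩ := Ultrafilter.exists_le (⨅ φ, 𝓟 (S φ))
  have hS : ∀ φ, S φ ∈ P := fun φ => hP (mem_iInf_of_mem φ (mem_principal_self _))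
  refine ⟨P, mem_of_superset (hS ⟨⊤, htop⟩) fun a ha => ha.1, fun φ => ⟨fun h =>
    mem_of_superset (hS ⟨φ, h⟩) fun a ha => ha.2, fun h => ?_⟩⟩
  by_contra hφ
  have h' : ∀ᶠ a in P, (Formula.not φ).Realize (e ∘ a) :=
    mem_of_superset (hS ⟨Formula.not φ, (p.has_not φ).2 hφ⟩) fun a ha => ha.2
  obtain ⟨a, ha, ha'⟩ := (h.and h').exists
  exact Formula.realize_not.1 ha' ha

/-- For a type definable over `M`, given as the limit of an ultrafilter `P` on tuples of `M`, the
defining formulas decide which formulas with parameters in `U` are true of almost all tuples. -/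
theorem IsDefinableOver.exists_definition {M : Type x} [L.Structure M] {e : M ↪ₑ[L] U}
    {p : GlobalType L U n} (hp : p.IsDefinableOver (range e)) {P : Ultrafilter (Fin n → M)}
    (hP : ∀ φ, p.Has φ ↔ ∀ᶠ a in P, φ.Realize (e ∘ a)) {γ : Type} [Finite γ]
    {S : Set (γ ⊕ Fin n → M)} (hS : univ.Definable L S) :
    ∃ (φ : L.Formula (M ⊕ (γ ⊕ Fin n))) (d : L.Formula (M ⊕ γ)),
      (∀ v, v ∈ S ↔ φ.Realize (Sum.elim id v)) ∧
      ∀ b : γ → U, d.Realize (Sum.elim e b) ↔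
        ∀ᶠ a in P, φ.Realize (Sum.elim e (Sum.elim b (e ∘ a))) := by
  obtain ⟨l, φ, c, hφ⟩ := exists_formula_of_definable_univ hS
  obtain ⟨m, ⟨E⟩⟩ := Finite.exists_equiv_fin (γ ⊕ Fin l)
  let f : (γ ⊕ Fin n) ⊕ Fin l → Fin m ⊕ Fin n :=
    Sum.elim (Sum.map (E ∘ Sum.inl) id) (Sum.inl ∘ E ∘ Sum.inr)
  obtain ⟨χ, hχ⟩ := definable_iff_exists_formula_sum.1 (hp m (φ.relabel f))
  refine ⟨φ.relabel (Sum.elim Sum.inr (Sum.inl ∘ c)), χ.relabel (Sum.elim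
    (Sum.inl ∘ rangeSplitting e) (Sum.elim Sum.inr (Sum.inl ∘ c) ∘ E.symm)), fun v => ?_,
    fun b => ?_⟩
  · rw [hφ, Formula.realize_relabel]
    refine iff_of_eq (congrArg _ ?_)
    ext (_ | _) <;> rfl
  · have h := Set.ext_iff.1 hχ (Sum.elim b (e ∘ c) ∘ E.symm)
    rw [mem_ofPred_eq, mem_ofPred_eq, hP] at h
    rw [Formula.realize_relabel]
    refine Iff.trans (iff_of_eq (congrArg _ ?_)) (h.symm.trans (iff_of_eq (congrArg
      (Filter.Eventually · _) ?_)))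
    · ext (t | t)
      · exact apply_rangeSplitting e t
      · simp only [Function.comp_apply, Sum.elim_inr]
        rcases E.symm t with _ | _ <;> rfl
    · ext a
      rw [realize_inst, Formula.realize_relabel, Formula.realize_relabel]
      refine iff_of_eq (congrArg _ ?_)
      ext ((_ | _) | _) <;> simp [f]

theorem IsDefinableOver.isDefinableAndCovered {M : Type x} [L.Structure M] {e : M ↪ₑ[L] U}
    {κ : Cardinal.{z}} (hU : IsSaturatedIn L U κ)
    (hκ : Cardinal.lift.{z} #M < Cardinal.lift.{x} κ)
    {p : GlobalType L U n} (hp : p.IsDefinableOver (range e)) {P : Ultrafilter (Fin n → M)}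
    (hP : ∀ φ, p.Has φ ↔ ∀ᶠ a in P, φ.Realize (e ∘ a)) : IsDefinableAndCovered L P := by
  classical
  have key : ∀ {γ : Type} (φ : L.Formula (M ⊕ (γ ⊕ Fin n))) (b : γ → M) (a : Fin n → M),
      φ.Realize (Sum.elim e (Sum.elim (e ∘ b) (e ∘ a))) ↔
        φ.Realize (Sum.elim id (Sum.elim b a)) := by
    intro γ φ b a
    rw [← Sum.comp_elim, e.realize_elim]
  refine ⟨fun {γ} _ S hS => ?_, fun {γ} _ S hS => ?_⟩
  · obtain ⟨φ, d, hφ, hd⟩ := hp.exists_definition hP hS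
    refine definable_univ_iff_exists_formula.2 ⟨d, fun b => ?_⟩
    rw [← e.realize_elim, hd]
    simp only [key, ← hφ]
    rfl
  · obtain ⟨φ, d, hφ, hd⟩ := hp.exists_definition hP hS
    by_contra! hF
    -- The set of formulas saying that `d(y)` holds but no tuple of `M` satisfies `φ(y, x)`.
    let g : (Fin n → M) → L.Formula (M ⊕ γ) := fun a =>
      d ⊓ ∼(φ.relabel (Sum.elim Sum.inl (Sum.elim Sum.inr fun t => Sum.inl (a t))))
    have hg : ∀ (a : Fin n → M) (b : γ → U), (g a).Realize (Sum.elim e b) ↔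
        d.Realize (Sum.elim e b) ∧ ¬ φ.Realize (Sum.elim e (Sum.elim b (e ∘ a))) := by
      intro a b
      rw [Formula.realize_inf, Formula.realize_not, Formula.realize_relabel]
      refine and_congr_right fun _ => not_congr (iff_of_eq (congrArg _ ?_))
      ext (_ | _ | _) <;> rfl
    obtain ⟨b, hb⟩ := hU.exists_realize e hκ (range g) (fun F hF' => by
      obtain ⟨F, rfl⟩ : ∃ F' : Finset (Fin n → M), F'.image g = F := by
        rw [← image_univ] at hF'
        obtain ⟨F', -, h⟩ := Finset.subset_set_image_iff.1 hF'
        exact ⟨F', h⟩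
      obtain ⟨b, hb, hbF⟩ := hF F
      refine ⟨e ∘ b, fun χ hχ => ?_⟩
      obtain ⟨a, ha, rfl⟩ := Finset.mem_image.1 hχ
      rw [hg, hd, key, ← hφ]
      simp only [key, ← hφ]
      exact ⟨hb, hbF a ha⟩)
    have hb' : ∀ a : Fin n → M, d.Realize (Sum.elim e b) ∧
        ¬ φ.Realize (Sum.elim e (Sum.elim b (e ∘ a))) := fun a => (hg a b).1 (hb _ ⟨a, rfl⟩)
    have : Nonempty (Fin n → M) := P.neBot.nonempty
    obtain ⟨a, ha⟩ := ((hd b).1 (hb' Classical.ofNonempty).1).exists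
    exact (hb' a).2 ha

end GlobalType

end FirstOrder.Language

/-! ### Extensions of generically stable types -/

namespace FirstOrder.Language.GlobalType

variable {L : FirstOrder.Language.{u, v}} {M : Type x} [L.Structure M] [Nonempty M]
  {N : Type y} [L.Structure N] {j : M ↪ₑ[L] N}
  {U : Type w} [L.Structure U] [(shelahLanguage L N).Structure U]
  [(toShelah L N).IsExpansionOn U] {i : ShelahExpansion j ↪ₑ[shelahLanguage L N] U}
  {κ : Cardinal.{w}} {n : ℕ} {p : GlobalType L U n} {q : GlobalType (shelahLanguage L N) U n}

/-- A type over `U` which is definable over `M` has at most one extension to the Shelah language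
that is finitely satisfiable in `M`. -/
theorem IsExtendedBy.unique (hM : HasNIP L (ShelahExpansion j)) (hN' : HasNIP L N)
    (hN : IsSaturatedIn L N (Order.succ #M))
    (hκ : Cardinal.lift.{w} #M < Cardinal.lift.{x} κ)
    (hU : IsSaturatedIn (shelahLanguage L N) U κ) (hp : p.IsDefinableOver (range i))
    (hpq : p.IsExtendedBy (toShelah L N) q) (hq : q.IsFinitelySatisfiableIn (range i))
    {q' : GlobalType (shelahLanguage L N) U n}
    (hpq' : p.IsExtendedBy (toShelah L N) q') (hq' : q'.IsFinitelySatisfiableIn (range i)) :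
    q = q' := by
  rw [← image_univ] at hq hq'
  obtain ⟨P, -, hP⟩ := hq.exists_ultrafilter
  obtain ⟨R, -, hR⟩ := hq'.exists_ultrafilter
  let e : ShelahExpansion j ↪ₑ[L] U := i.reduct (toShelah L N)
  have hsucc : Cardinal.lift.{x} #M < Cardinal.lift.{x} (Order.succ #M) :=
    Cardinal.lift_lt.2 (Order.lt_succ _)
  have hPp := hpq.has_iff_eventually hP
  have hRp := hpq'.has_iff_eventually hR
  have hPL : IsDefinableAndCovered L P :=
    IsDefinableOver.isDefinableAndCovered (e := e) (hU.reduct (toShelah L N)) hκ hp hPp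
  have hRL : IsDefinableAndCovered L R :=
    IsDefinableOver.isDefinableAndCovered (e := e) (hU.reduct (toShelah L N)) hκ hp hRp
  have hsh := ShelahExpansion.hasNIP hN hsucc hM hN'
  refine ext_of_has fun φ => ?_
  rw [hP, hR]
  refine (hPL.shelahExpansion hN hsucc hM).eventually_congr (hRL.shelahExpansion hN hsucc hM) hsh i
    (fun S hS => ?_) (definable_univ_realize φ)
  obtain ⟨D, hD, hDS⟩ := ShelahExpansion.isExternal_of_definable hN hsucc hM hS
  simp only [hDS]
  refine hPL.eventually_congr hRL hM (ShelahExpansion.embedding j) (fun S hS => ?_) hD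
  obtain ⟨φ, hφ⟩ := definable_univ_iff_exists_formula.1 hS
  let φ' : L[[U]].Formula (Fin n) :=
    BoundedFormula.constantsVarsEquiv.symm (φ.relabel (Sum.map e id))
  have hφ' : ∀ a : Fin n → ShelahExpansion j, a ∈ S ↔ φ'.Realize (i ∘ a) := by
    intro a
    rw [hφ, Formula.realize_constantsVarsEquiv_symm, Formula.realize_relabel, Sum.elim_comp_map,
      ← e.realize_elim]
    rfl
  simp only [hφ']
  rw [← hPp, ← hRp]

/-- A type over `U` which is definable over `M` and finitely satisfiable in `A ⊆ M` extends to the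
Shelah language: any ultrafilter on the tuples of `A` with limit `p` has a limit in the larger
language, which turns out to be definable even without parameters. -/
theorem exists_isExtendedBy (hM : HasNIP L (ShelahExpansion j)) (hN' : HasNIP L N)
    (hN : IsSaturatedIn L N (Order.succ #M))
    (hκ : Cardinal.lift.{w} #M < Cardinal.lift.{x} κ)
    (hU : IsSaturatedIn (shelahLanguage L N) U κ) (hp : p.IsDefinableOver (range i))
    {A : Set (ShelahExpansion j)} (hpA : p.IsFinitelySatisfiableIn (i '' A)) :
    ∃ q : GlobalType (shelahLanguage L N) U n, p.IsExtendedBy (toShelah L N) q ∧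
      q.IsDefinableOver ∅ ∧ q.IsFinitelySatisfiableIn (i '' A) := by
  obtain ⟨P, hPA, hP⟩ := hpA.exists_ultrafilter
  let e : ShelahExpansion j ↪ₑ[L] U := i.reduct (toShelah L N)
  have hsucc : Cardinal.lift.{x} #M < Cardinal.lift.{x} (Order.succ #M) :=
    Cardinal.lift_lt.2 (Order.lt_succ _)
  have hPL : IsDefinableAndCovered L P :=
    IsDefinableOver.isDefinableAndCovered (e := e) (hU.reduct (toShelah L N)) hκ hp hP
  have hsh := ShelahExpansion.hasNIP hN hsucc hM hN'
  have : Nonempty U := ⟨i Classical.ofNonempty⟩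
  have hq : ∀ φ, (ofUltrafilter (L := shelahLanguage L N) (P.map (i ∘ ·))).Has φ ↔
      ∀ᶠ a in P, φ.Realize (i ∘ a) := has_ofUltrafilter _
  refine ⟨ofUltrafilter (P.map (i ∘ ·)), fun φ hφ => ?_, fun m φ => ?_, fun φ hφ => ?_⟩
  · rw [hq]
    simp only [LHom.realize_onFormula]
    exact (hP φ).1 hφ
  · have hφ : univ.Definable (shelahLanguage L N)
        {v : Fin m ⊕ Fin n → ShelahExpansion j | φ.Realize v} :=
      definable_univ_iff_exists_formula.2 ⟨φ.relabel Sum.inr, fun v => by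
        rw [Formula.realize_relabel]; rfl⟩
    obtain ⟨δ, hδ⟩ := ShelahExpansion.exists_formula_of_isExternal (hPL.definable_external hM
      (ShelahExpansion.isExternal_of_definable hN hsucc hM hφ))
    refine empty_definable_iff.2 ⟨δ, ?_⟩
    ext b
    have h := (hPL.shelahExpansion hN hsucc hM).realize_iff_eventually hsh i φ (δ.relabel Sum.inr)
      (fun b => by rw [Formula.realize_relabel]; exact hδ b) b
    rw [Formula.realize_relabel] at h
    rw [mem_ofPred_eq, hq]
    simp only [realize_inst]
    exact h.symm
  · obtain ⟨a, ha, haA⟩ := (((hq φ).1 hφ).and hPA).exists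
    exact ⟨i ∘ a, fun k => mem_image_of_mem i (haA k), ha⟩

end FirstOrder.Language.GlobalType

end

theorem mainTheorem9 {L : FirstOrder.Language.{u, v}} {T : L.Theory} (hT : T.IsComplete) (hNIP : T.IsNIP)
    {M : Type x} [L.Structure M] [Nonempty M] (hM : M ⊨ T)
    {N : Type y} [L.Structure N] (j : M ↪ₑ[L] N) (hN : IsSaturatedIn L N (Order.succ #M))
    {U : Type w} [L.Structure U] [(shelahLanguage L N).Structure U]
    [(toShelah L N).IsExpansionOn U]
    (i : ShelahExpansion j ↪ₑ[shelahLanguage L N] U)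
    {κ : Cardinal.{w}} (hκ : Cardinal.lift.{w} #M < Cardinal.lift.{x} κ)
    (hU : IsSaturatedIn (shelahLanguage L N) U κ)
    {n : ℕ} (p : GlobalType L U n) :
    (∀ A : Set (ShelahExpansion j),
      p.IsDefinableOver (i '' A) → p.IsFinitelySatisfiableIn (i '' A) →
        (∃! q : GlobalType (shelahLanguage L N) U n, p.IsExtendedBy (toShelah L N) q ∧
          q.IsDefinableOver (i '' A) ∧ q.IsFinitelySatisfiableIn (i '' A)) ∧
        (∀ q : GlobalType (shelahLanguage L N) U n, p.IsExtendedBy (toShelah L N) q →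
          q.IsDefinableOver (i '' A) → q.IsFinitelySatisfiableIn (i '' A) →
            q.IsGenericallyStableOver (Set.range i))) ∧
    (p.IsGenericallyStableOver (Set.range i) →
      ∃! q : GlobalType (shelahLanguage L N) U n, p.IsExtendedBy (toShelah L N) q ∧
        q.IsGenericallyStableOver (Set.range i)) := by
  have hM' : HasNIP L M := hNIP.hasNIP hM
  have hN' : HasNIP L N :=
    have : Nonempty N := ⟨j Classical.ofNonempty⟩
    hNIP.hasNIP ((j.theory_model_iff T).1 hM)
  have hrange := i.exists_elementarySubstructure_eq_range
  refine ⟨fun A hdef hfs => ⟨?_, ?_⟩, fun ⟨_, hdef, hfs⟩ => ?_⟩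
  · have hA := Set.image_subset_range i A
    obtain ⟨q, hpq, hqdef, hqfs⟩ :=
      GlobalType.exists_isExtendedBy hM' hN' hN hκ hU (hdef.mono hA) hfs
    exact ⟨q, ⟨hpq, hqdef.mono (Set.empty_subset _), hqfs⟩, fun r ⟨hpr, _, hrfs⟩ =>
      hpr.unique hM' hN' hN hκ hU (hdef.mono hA) (hrfs.mono hA) hpq (hqfs.mono hA)⟩
  · exact fun q _ hqdef hqfs => ⟨hrange, hqdef.mono (Set.image_subset_range i A),
      hqfs.mono (Set.image_subset_range i A)⟩
  · obtain ⟨q, hpq, hqdef, hqfs⟩ := GlobalType.exists_isExtendedBy hM' hN' hN hκ hU hdef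
      (A := Set.univ) (by rwa [Set.image_univ])
    rw [Set.image_univ] at hqfs
    exact ⟨q, ⟨hpq, hrange, hqdef.mono (Set.empty_subset _), hqfs⟩, fun r ⟨hpr, _, _, hrfs⟩ =>
      hpr.unique hM' hN' hN hκ hU hdef hrfs hpq hqfs⟩
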